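/- Let $X_1,\dots,X_p$ be discrete random variables, $X_i$ with state space $[d_i]$, and write $\mathcal R_A=\prod_{i\in A}[d_i]$ for $A\subseteq[p]$. The event tree has as vertices at level $k$ ($0\le k\le p$) the outcomes $x_1\cdots x_k\in\mathcal R_{[k]}$, with an edge from $v=x_1\cdots x_{k-1}$ to $vs$ for every $s\in[d_k]$; let $E(v)$ be the set of edges leaving $v$. A labelling $\theta$ of the edges makes it a *staged tree* $\mathcal T$ if, for each vertex $v$, the edges in $E(v)$ have distinct labels, and, for all vertices $v,w$, the sets $\theta(E(v))$, $\theta(E(w))$ are equal or disjoint; $v,w$ are in the same *stage* if these sets are equal. $\mathcal T$ is a *CStree* if (1) vertices of different levels are in different stages; (2) if $v,w$ at level $k-1$ are in the same stage, then $\theta(v\to vs)=\theta(w\to ws)$ for all $s\in[d_k]$; (3) every stage in level $k-1$ is of the form $\{v\in\mathcal R_{[k-1]}: v_C=\mathbf x_C\}$ for some $C\subseteq[k-1]$ and $\mathbf x_C\in\mathcal R_C$. *CSI statements.* For a stage $S$ in level $k-1$ let $C$ be the set of all indices in $[k-1]$ at which all elements of $S$ agree, and $\mathbf x_C$ their common value;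 $S$ gives the context-specific independence (CSI) statement $X_k\perp X_{[k-1]\setminus C}\mid X_C=\mathbf x_C$. Let $\mathcal J(\mathcal T)$ be the closure of these statements under the following axioms for CSI statements $X_A\perp X_B\mid X_S,X_C=\mathbf x_C$ (with $A,B,S,C$ pairwise disjoint; the sets named in an axiom are disjoint, and the context $X_C=\mathbf x_C$ is kept fixed in the first five): symmetry; decomposition ($A\perp B\cup D\mid S\Rightarrow A\perp B\mid S$); weak union ($A\perp B\cup D\mid S\Rightarrow A\perp B\mid S\cup D$); contraction ($A\perp B\mid S\cup D$ and $A\perp D\mid S\Rightarrow A\perp B\cup D\mid S$); intersection ($A\perp B\mid S\cup D$ and $A\perp S\mid B\cup D\Rightarrow A\perp B\cup S\mid D$); specialization ($X_A\perp X_B\mid X_S,X_C=\mathbf x_C\Rightarrow X_A\perp X_B\mid X_{S\setminus T},X_{C\cup T}=\mathbf x_{C\cup T}$ for all $T\subseteq S$ and $\mathbf x_T\in\mathcal R_T$); absorption (if $T\subseteq C$ and $X_A\perp X_B\mid X_S,X_{C\setminus T}=\mathbf x_{C\setminus T},X_T=\mathbf y_T$ for all $\mathbf y_T\in\mathcal R_T$,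 then $X_A\perp X_B\mid X_{S\cup T},X_{C\setminus T}=\mathbf x_{C\setminus T}$). *Minimal context DAGs.* $X_C=\mathbf x_C$ is a *minimal context* of $\mathcal T$ if there is a statement $X_A\perp X_B\mid X_S,X_C=\mathbf x_C$ in $\mathcal J(\mathcal T)$ with $A,B\ne\emptyset$ such that $X_A\perp X_B\mid X_{S\cup T},X_{C\setminus T}=\mathbf x_{C\setminus T}$ is not in $\mathcal J(\mathcal T)$ for any nonempty $T\subseteq C$. A *minimal context DAG* for it is a DAG $G$ on $[p]\setminus C$, all of whose edges $i\to j$ satisfy $i<j$, that is a minimal I-MAP of $\{X_A\perp X_B\mid X_S : X_A\perp X_B\mid X_S,X_C=\mathbf x_C\in\mathcal J(\mathcal T)\}$: all d-separation statements of $G$ with $A,B\neq\emptyset$ are in this set, and this fails after the removal of any single edge of $G$. A DAG is *perfect* if any two distinct parents of any vertex are adjacent. *Balanced.* For a vertex $v$ at level $k$ let $t(v)=\sum_{\mathbf z\in\mathcal R_{[p]\setminus[k]}}\prod_{e}\theta(e)\in\mathbb R[\theta(e):e\in E]$, where $e$ runs over the edges on the path from $v$ to the leaf $v\mathbf z$.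 $\mathcal T$ is *balanced* if $t(vs)\,t(wr)=t(vr)\,t(ws)$ in this polynomial ring for all $k\in[p]$, all $v,w$ at level $k-1$ in the same stage, and all $s,r\in[d_k]$. **Theorem.** Let $\mathcal T$ be a CStree on any number $p$ of variables. If every minimal context DAG of $\mathcal T$ is perfect, then $\mathcal T$ is balanced. -/

import Mathlib

/-! The random variables are `X_i`, `i : Fin p`, in their natural order, and `X_i` has state space
`Fin (d i)`. A vertex of the event tree at level `k` is an outcome of the variables `X_i`, `i < k`;
level `0` is the root and level `p` consists of the leaves. -/

/-- Outcomes of all variables, i.e. the leaves of the event tree. -/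
abbrev Outcome {p : ℕ} (d : Fin p → ℕ) : Type := (i : Fin p) → Fin (d i)

/-- Vertices of the event tree at level `k`. -/
abbrev TreeNode {p : ℕ} (d : Fin p → ℕ) (k : ℕ) : Type := (i : Fin p) → i.val < k → Fin (d i)

/-- The vertex at level `k` on the path from the root to the leaf `x`. -/
def Outcome.truncate {p : ℕ} {d : Fin p → ℕ} (x : Outcome d) (k : ℕ) : TreeNode d k :=
  fun i _ => x i

/-- The child `vs` of the vertex `v` that appends the outcome `s` of `X_k` to `v`. -/
def TreeNode.child {p : ℕ} {d : Fin p → ℕ} {k : Fin p} (v : TreeNode d k.val) (s : Fin (d k)) :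
    TreeNode d (k.val + 1) :=
  fun i hi =>
    if h : i.val < k.val then v i h
    else Fin.cast (congrArg d (Fin.ext (by omega) : k = i)) s

/-! ### Contexts and context-specific independence statements -/

/-- A context `X_C = x_C`, as a partial assignment; `C` is the set of assigned indices. -/
abbrev Context {p : ℕ} (d : Fin p → ℕ) : Type := (i : Fin p) → Option (Fin (d i))

/-- The index set `C` of the context `X_C = x_C`. -/
def Context.supp {p : ℕ} {d : Fin p → ℕ} (c : Context d) : Finset (Fin p) :=
  Finset.univ.filter fun i => (c i).isSome

/-- The context `X_{C \ T} = x_{C \ T}`. -/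
def Context.erase {p : ℕ} {d : Fin p → ℕ} (c : Context d) (T : Finset (Fin p)) : Context d :=
  fun i => if i ∈ T then none else c i

/-- The vertex `v` is compatible with the context. -/
def Context.Agrees {p : ℕ} {d : Fin p → ℕ} (c : Context d) {k : ℕ} (v : TreeNode d k) : Prop :=
  ∀ (i : Fin p) (hi : i.val < k) (a : Fin (d i)), c i = some a → v i hi = a

/-- The CSI statement `X_A ⫫ X_B | X_S, X_C = x_C`, where `ctx` is the context `X_C = x_C`. -/
structure CSIStatement {p : ℕ} (d : Fin p → ℕ) where
  A : Finset (Fin p)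
  B : Finset (Fin p)
  S : Finset (Fin p)
  ctx : Context d

/-- The closure of a set of CSI statements under the CSI axioms. All statements occurring here have
pairwise disjoint `A`, `B`, `S`, `C` as soon as those in `base` do. -/
inductive CSIClosure {p : ℕ} {d : Fin p → ℕ} (base : Set (CSIStatement d)) :
    CSIStatement d → Prop
  | of_base {σ : CSIStatement d} : σ ∈ base → CSIClosure base σ
  | symmetry {A B S : Finset (Fin p)} {c : Context d} :
      CSIClosure base ⟨A, B, S, c⟩ → CSIClosure base ⟨B, A, S, c⟩
  | decomposition {A B D S : Finset (Fin p)} {c : Context d} :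
      CSIClosure base ⟨A, B ∪ D, S, c⟩ → CSIClosure base ⟨A, B, S, c⟩
  | weak_union {A B D S : Finset (Fin p)} {c : Context d} : Disjoint B D →
      CSIClosure base ⟨A, B ∪ D, S, c⟩ → CSIClosure base ⟨A, B, S ∪ D, c⟩
  | contraction {A B D S : Finset (Fin p)} {c : Context d} :
      CSIClosure base ⟨A, B, S ∪ D, c⟩ → CSIClosure base ⟨A, D, S, c⟩ →
      CSIClosure base ⟨A, B ∪ D, S, c⟩
  | intersection {A B D S : Finset (Fin p)} {c : Context d} :
      CSIClosure base ⟨A, B, S ∪ D, c⟩ → CSIClosure base ⟨A, S, B ∪ D, c⟩ →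
      CSIClosure base ⟨A, B ∪ S, D, c⟩
  /-- From the context `X_C = x_C` to a context `c` that in addition fixes `X_T`, where `T ⊆ S`. -/
  | specialization {A B S T : Finset (Fin p)} {c : Context d} : T ⊆ S → T ⊆ c.supp →
      CSIClosure base ⟨A, B, S, c.erase T⟩ → CSIClosure base ⟨A, B, S \ T, c⟩
  /-- The contexts `c'` are those obtained from `c` by changing the outcome of `X_T`. -/
  | absorption {A B S T : Finset (Fin p)} {c : Context d} : T ⊆ c.supp →
      (∀ c' : Context d, c'.supp = c.supp → c'.erase T = c.erase T →
        CSIClosure base ⟨A, B, S, c'⟩) →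
      CSIClosure base ⟨A, B, S ∪ T, c.erase T⟩

/-! ### Directed acyclic graphs -/

/-- A DAG with vertex set `W ⊆ {X_i}` for which the order of the variables is topological. -/
structure OrderedDAG {p : ℕ} (W : Finset (Fin p)) where
  edge : Fin p → Fin p → Prop
  mem_of_edge : ∀ i j, edge i j → i ∈ W ∧ j ∈ W
  lt_of_edge : ∀ i j, edge i j → i < j

namespace OrderedDAG

/-- Adjacency in the skeleton. -/
def Adj {p : ℕ} {W : Finset (Fin p)} (G : OrderedDAG W) (i j : Fin p) : Prop :=
  G.edge i j ∨ G.edge j i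

/-- `G` is perfect: the parents of every vertex are pairwise adjacent. -/
def IsPerfect {p : ℕ} {W : Finset (Fin p)} (G : OrderedDAG W) : Prop :=
  ∀ k i j, G.edge i k → G.edge j k → i ≠ j → G.Adj i j

/-- `G.ActiveTrail S a u v`: there is a trail `a, …, u, v` in the skeleton of `G` (its last step
goes from `u` to `v`) that is active given `S`: every inner vertex at which two arrows of the trail
meet head to head is in `S` or has a descendant in `S`, and no other inner vertex is in `S`. -/
inductive ActiveTrail {p : ℕ} {W : Finset (Fin p)} (G : OrderedDAG W) (S : Finset (Fin p))
    (a : Fin p) : Fin p → Fin p → Prop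
  | single {v : Fin p} : G.Adj a v → ActiveTrail G S a a v
  | extend {u v w : Fin p} : ActiveTrail G S a u v → G.Adj v w →
      (G.edge u v ∧ G.edge w v → ∃ s ∈ S, Relation.ReflTransGen G.edge v s) →
      (¬ (G.edge u v ∧ G.edge w v) → v ∉ S) →
      ActiveTrail G S a v w

/-- `S` d-separates `A` and `B` (for pairwise disjoint `A`, `B`, `S`). -/
def DSep {p : ℕ} {W : Finset (Fin p)} (G : OrderedDAG W) (A B S : Finset (Fin p)) : Prop :=
  ∀ a ∈ A, ∀ b ∈ B, ∀ u, ¬ G.ActiveTrail S a u b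

/-- `G` is an I-MAP of a set `I` of CI statements `X_A ⫫ X_B | X_S`: all (nontrivial)
d-separation statements of `G` belong to `I`. -/
def IsIMap {p : ℕ} {W : Finset (Fin p)} (G : OrderedDAG W)
    (I : Finset (Fin p) → Finset (Fin p) → Finset (Fin p) → Prop) : Prop :=
  ∀ A B S : Finset (Fin p), A ⊆ W → B ⊆ W → S ⊆ W → A.Nonempty → B.Nonempty →
    Disjoint A B → Disjoint A S → Disjoint B S → G.DSep A B S → I A B S

/-- The DAG obtained by removing the edge `i → j`. -/
def removeEdge {p : ℕ} {W : Finset (Fin p)} (G : OrderedDAG W) (i j : Fin p) : OrderedDAG W where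
  edge a b := G.edge a b ∧ ¬ (a = i ∧ b = j)
  mem_of_edge a b h := G.mem_of_edge a b h.1
  lt_of_edge a b h := G.lt_of_edge a b h.1

/-- `G` is a minimal I-MAP of `I`: it is an I-MAP, and removing any one edge destroys this. -/
def IsMinimalIMap {p : ℕ} {W : Finset (Fin p)} (G : OrderedDAG W)
    (I : Finset (Fin p) → Finset (Fin p) → Finset (Fin p) → Prop) : Prop :=
  G.IsIMap I ∧ ∀ i j, G.edge i j → ¬ (G.removeEdge i j).IsIMap I

end OrderedDAG

/-! ### Staged trees and CStrees -/

/-- A staged tree: `label k v s` is the label of the edge from the vertex `v` at level `k` to its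
child `vs`; the edges out of one vertex have distinct labels, and the label sets of two vertices
are equal or disjoint. -/
structure StagedTree {p : ℕ} (d : Fin p → ℕ) (L : Type*) where
  label : (k : Fin p) → TreeNode d k.val → Fin (d k) → L
  label_injective : ∀ k v, Function.Injective (label k v)
  eq_or_disjoint : ∀ k v l w, Set.range (label k v) = Set.range (label l w) ∨
    Disjoint (Set.range (label k v)) (Set.range (label l w))

namespace StagedTree

/-- Two vertices of the same level are in the same stage. -/
def SameStage {p : ℕ} {d : Fin p → ℕ} {L : Type*} (𝒯 : StagedTree d L) (k : Fin p)
    (v w : TreeNode d k.val) : Prop :=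
  Set.range (𝒯.label k v) = Set.range (𝒯.label k w)

/-- The staged tree is a CStree. -/
structure IsCStree {p : ℕ} {d : Fin p → ℕ} {L : Type*} (𝒯 : StagedTree d L) : Prop where
  /-- Vertices of different levels are in different stages. -/
  level_ne : ∀ k v l w, k ≠ l → Set.range (𝒯.label k v) ≠ Set.range (𝒯.label l w)
  /-- In one stage, equally labelled edges point to the same outcome. -/
  label_eq : ∀ k v w, 𝒯.SameStage k v w → ∀ s, 𝒯.label k v s = 𝒯.label k w s
  /-- Every stage consists of all vertices of its level that agree with some context. -/
  stage_eq : ∀ k v, ∃ c : Context d, (∀ i ∈ c.supp, i < k) ∧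
    ∀ w, 𝒯.SameStage k v w ↔ c.Agrees w

open Classical in
/-- The stage-defining context `X_C = x_C` of the stage of `v`: `C` consists of all indices `i`
such that all elements of the stage have the same outcome of `X_i`. -/
noncomputable def stageContext {p : ℕ} {d : Fin p → ℕ} {L : Type*} (𝒯 : StagedTree d L)
    (k : Fin p) (v : TreeNode d k.val) : Context d :=
  fun i =>
    if hi : i.val < k.val then
      if ∀ w, 𝒯.SameStage k v w → w i hi = v i hi then some (v i hi) else none
    else none

/-- The CSI statements `X_k ⫫ X_{[k-1] \ C} | X_C = x_C` given by the stages. -/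
def stageStatements {p : ℕ} {d : Fin p → ℕ} {L : Type*} (𝒯 : StagedTree d L) :
    Set (CSIStatement d) :=
  {σ | ∃ (k : Fin p) (v : TreeNode d k.val),
    σ = ⟨{k}, Finset.Iio k \ (𝒯.stageContext k v).supp, ∅, 𝒯.stageContext k v⟩}

/-- The set `𝒥(𝒯)` of all CSI statements implied by `𝒯` through the CSI axioms. -/
def Implies {p : ℕ} {d : Fin p → ℕ} {L : Type*} (𝒯 : StagedTree d L) (σ : CSIStatement d) :
    Prop :=
  CSIClosure 𝒯.stageStatements σ

/-- `X_C = x_C` is a minimal context: some nontrivial statement `X_A ⫫ X_B | X_S, X_C = x_C` is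
implied, and for no nonempty `T ⊆ C` is `X_A ⫫ X_B | X_{S ∪ T}, X_{C \ T} = x_{C \ T}` implied. -/
def IsMinimalContext {p : ℕ} {d : Fin p → ℕ} {L : Type*} (𝒯 : StagedTree d L)
    (c : Context d) : Prop :=
  ∃ A B S : Finset (Fin p), A.Nonempty ∧ B.Nonempty ∧ 𝒯.Implies ⟨A, B, S, c⟩ ∧
    ∀ T : Finset (Fin p), T ⊆ c.supp → T.Nonempty → ¬ 𝒯.Implies ⟨A, B, S ∪ T, c.erase T⟩

/-- The CI statements `X_A ⫫ X_B | X_S` that hold in the context `c`. -/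
def ContextCI {p : ℕ} {d : Fin p → ℕ} {L : Type*} (𝒯 : StagedTree d L) (c : Context d)
    (A B S : Finset (Fin p)) : Prop :=
  𝒯.Implies ⟨A, B, S, c⟩

/-- `G` is a minimal context DAG of `𝒯` for the minimal context `c`: a minimal I-MAP, on the
variables outside the context and in their order, of the CI statements that hold in `c`. -/
def IsMinimalContextDAG {p : ℕ} {d : Fin p → ℕ} {L : Type*} (𝒯 : StagedTree d L)
    (c : Context d) (G : OrderedDAG (c.supp)ᶜ) : Prop :=
  𝒯.IsMinimalContext c ∧ G.IsMinimalIMap (𝒯.ContextCI c)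

open Classical in
/-- The interpolating polynomial `t(v)` of a vertex at level `k`: the sum over all leaves `x` below
`v` of the product of the labels on the path from `v` to `x`. -/
noncomputable def interpolatingPoly {p : ℕ} {d : Fin p → ℕ} {L : Type*} (𝒯 : StagedTree d L)
    {k : ℕ} (v : TreeNode d k) : MvPolynomial L ℝ :=
  ∑ x ∈ Finset.univ.filter (fun x : Outcome d => x.truncate k = v),
    ∏ j ∈ Finset.univ.filter (fun j : Fin p => k ≤ j.val),
      MvPolynomial.X (𝒯.label j (x.truncate j.val) (x j))

/-- `t(vs) t(wr) = t(vr) t(ws)` for all `v`, `w` in the same stage and all outcomes `s`, `r` of the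
next variable. -/
def IsBalanced {p : ℕ} {d : Fin p → ℕ} {L : Type*} (𝒯 : StagedTree d L) : Prop :=
  ∀ (k : Fin p) (v w : TreeNode d k.val), 𝒯.SameStage k v w → ∀ s r : Fin (d k),
    𝒯.interpolatingPoly (v.child s) * 𝒯.interpolatingPoly (w.child r) =
      𝒯.interpolatingPoly (v.child r) * 𝒯.interpolatingPoly (w.child s)

end StagedTree

/-! ### Contexts -/

namespace Context

variable {p : ℕ} {d : Fin p → ℕ}

/-! Each level of a root-to-leaf path `x` has a stage with a context. Everything rests on one
nesting property: if `i < m` both lie in the context at level `n`, then `i` lies in the context at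
level `m` (`mem_supp_stageContext`). Otherwise the stage at `m` makes `X_m` independent of `X_i`.
Moving as much as possible of its context into the conditioning set gives a minimal context, for
which the complete DAG without `i → m` is an I-MAP. A minimal I-MAP inside it keeps `i → n` and `m →
n`, because the axioms imply independence of `X_n` from neither variable; that underivability comes
from the invariant `Untangled`. Perfectness then forces an edge between `i` and `m`, a
contradiction.

By nesting, the stage at `n` is determined by the last variable of its context, through the stage
and outcome at that variable's level. Induction from the leaves upwards then writes every
interpolating polynomial as a constant times one factor per earlier level, each depending only on
the stage and outcome there (`interpolatingPoly_eq_prod`). In the balance equation only the factor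
at level `k` involves `s` and `r`, and it is the same for `v` and `w`. -/

theorem mem_supp {c : Context d} {i : Fin p} : i ∈ c.supp ↔ ∃ a, c i = some a := by
  simp [supp, Option.isSome_iff_exists]

/-- Two contexts are compatible if they assign no variable different outcomes. -/
def Compatible (c e : Context d) : Prop :=
  ∀ i a b, c i = some a → e i = some b → a = b

theorem erase_eq_some {c : Context d} {T : Finset (Fin p)} {i : Fin p} {a : Fin (d i)} :
    c.erase T i = some a ↔ i ∉ T ∧ c i = some a := by
  unfold erase
  split_ifs with h <;> simp [h]

theorem supp_erase (c : Context d) (T : Finset (Fin p)) : (c.erase T).supp = c.supp \ T := by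
  ext i
  simp only [mem_supp, erase_eq_some, Finset.mem_sdiff]
  tauto

theorem erase_empty (c : Context d) : c.erase ∅ = c := by
  funext i
  simp [erase]

theorem erase_erase (c : Context d) (T U : Finset (Fin p)) :
    (c.erase T).erase U = c.erase (T ∪ U) := by
  funext i
  simp only [erase, Finset.mem_union]
  split_ifs <;> tauto

end Context

/-! ### An invariant of the CSI axioms -/

/-- The statements valid in a model in which, within the context `e`, the variables `X_k` and `X_i`,
`i ∈ e.supp`, interact all together once `X_k` is observed, and there is no other interaction. -/
def CSIStatement.Untangled {p : ℕ} {d : Fin p → ℕ} (k : Fin p) (e : Context d)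
    (σ : CSIStatement d) : Prop :=
  (k ∉ σ.A ∧ k ∉ σ.B ∧ k ∉ σ.S ∧ k ∉ σ.ctx.supp) ∨ ¬ σ.ctx.Compatible e ∨
    Disjoint σ.A (insert k e.supp) ∨ Disjoint σ.B (insert k e.supp)

/-- Soundness of the axioms for this model, checked axiom by axiom. It serves to show that certain
statements cannot be derived. -/
theorem CSIClosure.untangled {p : ℕ} {d : Fin p → ℕ} {base : Set (CSIStatement d)} {k : Fin p}
    {e : Context d} (hbase : ∀ σ ∈ base, σ.Untangled k e) {σ : CSIStatement d}
    (hσ : CSIClosure base σ) : σ.Untangled k e := by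
  induction hσ with
  | of_base h => exact hbase _ h
  | symmetry _ ih =>
    simp only [CSIStatement.Untangled] at *
    tauto
  | decomposition _ ih =>
    simp only [CSIStatement.Untangled, Finset.mem_union, Finset.disjoint_union_left] at *
    tauto
  | weak_union _ _ ih =>
    simp only [CSIStatement.Untangled, Finset.mem_union, Finset.disjoint_union_left] at *
    tauto
  | contraction _ _ ih₁ ih₂ =>
    simp only [CSIStatement.Untangled, Finset.mem_union, Finset.disjoint_union_left] at *
    rcases ih₁ with h₁ | h₁ | h₁ | h₁
    · exact Or.inl (by tauto)
    · exact Or.inr (Or.inl h₁)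
    · exact Or.inr (Or.inr (Or.inl h₁))
    · rcases ih₂ with h₂ | h₂ | h₂ | h₂
      -- The second premise omits `k`, and `B` avoids `k`, so the conclusion omits `k` as well.
      · have hkB := (Finset.disjoint_insert_right.1 h₁).1
        exact Or.inl (by tauto)
      · exact Or.inr (Or.inl h₂)
      · exact Or.inr (Or.inr (Or.inl h₂))
      · exact Or.inr (Or.inr (Or.inr ⟨h₁, h₂⟩))
  | intersection _ _ ih₁ ih₂ =>
    simp only [CSIStatement.Untangled, Finset.mem_union, Finset.disjoint_union_left] at *
    rcases ih₁ with h₁ | h₁ | h₁ | h₁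
    · exact Or.inl (by tauto)
    · exact Or.inr (Or.inl h₁)
    · exact Or.inr (Or.inr (Or.inl h₁))
    · rcases ih₂ with h₂ | h₂ | h₂ | h₂
      · exact Or.inl (by tauto)
      · exact Or.inr (Or.inl h₂)
      · exact Or.inr (Or.inr (Or.inl h₂))
      · exact Or.inr (Or.inr (Or.inr ⟨h₁, h₂⟩))
  | @specialization A B S T c hTS hTc _ ih =>
    simp only [CSIStatement.Untangled, Context.supp_erase, Finset.mem_sdiff] at *
    have hcompat : c.Compatible e → (c.erase T).Compatible e := fun h i a b ha hb =>
      h i a b (Context.erase_eq_some.1 ha).2 hb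
    have hkT : k ∈ T → k ∈ S := fun h => hTS h
    tauto
  | @absorption A B S T c hTc _ ih =>
    by_cases hc : (c.erase T).Compatible e
    · classical
      -- One premise of absorption is enough: the one whose outcomes on `T` are overwritten by those
      -- of `e` wherever `e` assigns any. This keeps the context compatible with `e`.
      let c' : Context d := fun i => if i ∈ T then (e i).or (c i) else c i
      have hsupp : c'.supp = c.supp := by
        ext i
        by_cases hi : i ∈ T
        · have hmem := Context.mem_supp.1 (hTc hi)
          obtain ⟨a, ha⟩ := hmem
          cases he : e i <;> simp [Context.supp, c', hi, ha, he]
        · simp [Context.supp, c', hi]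
      have herase : c'.erase T = c.erase T := by
        funext i
        by_cases hi : i ∈ T <;> simp [Context.erase, c', hi]
      have hc' : c'.Compatible e := by
        intro i a b ha hb
        by_cases hi : i ∈ T
        · simp only [c', hi, if_true, hb, Option.some_or, Option.some.injEq] at ha
          exact ha.symm
        · refine hc i a b ?_ hb
          rw [Context.erase_eq_some]
          exact ⟨hi, by simpa [c', hi] using ha⟩
      have h := ih c' hsupp herase
      have hkT : k ∈ T → k ∈ c.supp := fun h => hTc h
      simp only [CSIStatement.Untangled, hsupp, Context.supp_erase, Finset.mem_sdiff,
        Finset.mem_union] at *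
      tauto
    · exact Or.inr (Or.inl hc)

/-! ### I-MAPs -/

namespace OrderedDAG

variable {p : ℕ} {W : Finset (Fin p)}

/-- The DAG with all edges on `W` that respect the order, except `i → m`. -/
def completeMinus (W : Finset (Fin p)) (i m : Fin p) : OrderedDAG W where
  edge a b := a ∈ W ∧ b ∈ W ∧ a < b ∧ ¬ (a = i ∧ b = m)
  mem_of_edge _ _ h := ⟨h.1, h.2.1⟩
  lt_of_edge _ _ h := h.2.2.1

theorem completeMinus_adj {i m a b : Fin p} (ha : a ∈ W) (hb : b ∈ W) (hab : a ≠ b)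
    (h₁ : ¬ (a = i ∧ b = m)) (h₂ : ¬ (b = i ∧ a = m)) : (completeMinus W i m).Adj a b := by
  rcases lt_or_gt_of_ne hab with h | h
  · exact Or.inl ⟨ha, hb, h, h₁⟩
  · exact Or.inr ⟨hb, ha, h, h₂⟩

/-- The only d-separation statement of the complete DAG without the edge `i → m` is that `i` and `m`
are separated by the other predecessors of `m`. -/
theorem completeMinus_separator {i m a b : Fin p} {S : Finset (Fin p)}
    (him : i < m) (hab : (a = i ∧ b = m) ∨ (a = m ∧ b = i)) (hi : i ∈ W) (hm : m ∈ W) (hS : S ⊆ W)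
    (haS : a ∉ S) (hbS : b ∉ S) (h : ∀ u, ¬ (completeMinus W i m).ActiveTrail S a u b) :
    S = (Finset.Iio m \ {i}) ∩ W := by
  have ha : a ∈ W := by rcases hab with h | h <;> simp [h.1, hi, hm]
  have hb : b ∈ W := by rcases hab with h | h <;> simp [h.2, hi, hm]
  have hane : ∀ s ∈ W, s ≠ i → s ≠ m → (completeMinus W i m).Adj a s := fun s hs h₁ h₂ =>
    completeMinus_adj ha hs (by rintro rfl; rcases hab with h | h <;> simp_all)
      (by tauto) (by tauto)
  have hbne : ∀ s ∈ W, s ≠ i → s ≠ m → (completeMinus W i m).Adj s b := fun s hs h₁ h₂ =>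
    completeMinus_adj hs hb (by rintro rfl; rcases hab with h | h <;> simp_all)
      (by tauto) (by tauto)
  ext s
  simp only [Finset.mem_inter, Finset.mem_sdiff, Finset.mem_Iio, Finset.mem_singleton]
  constructor
  · intro hs
    have hsi : s ≠ i := by rintro rfl; rcases hab with h | h <;> simp_all
    have hsm : s ≠ m := by rintro rfl; rcases hab with h | h <;> simp_all
    refine ⟨⟨?_, hsi⟩, hS hs⟩
    by_contra hlt
    have hms : m < s := lt_of_le_of_ne (not_lt.1 hlt) hsm.symm
    -- An element `s` of `S` beyond `m` is an observed collider `i → s ← m`.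
    refine h s (.extend (.single (hane s (hS hs) hsi hsm)) (hbne s (hS hs) hsi hsm)
      (fun _ => ⟨s, hs, .refl⟩) fun hn => absurd ?_ hn)
    have his := him.trans hms
    rcases hab with ⟨rfl, rfl⟩ | ⟨rfl, rfl⟩
    · exact ⟨⟨hi, hS hs, his, by tauto⟩, ⟨hm, hS hs, hms, by tauto⟩⟩
    · exact ⟨⟨hm, hS hs, hms, by tauto⟩, ⟨hi, hS hs, his, by tauto⟩⟩
  · rintro ⟨⟨hsm, hsi⟩, hsW⟩
    by_contra hs
    -- An unobserved `s` before `m` has an arrow to `m`, so it is no collider and the trail through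
    -- it is active.
    refine h s (.extend (.single (hane s hsW hsi hsm.ne)) (hbne s hsW hsi hsm.ne)
      (fun hn => ?_) fun _ => hs)
    have h₁ := (completeMinus W i m).lt_of_edge _ _ hn.1
    have h₂ := (completeMinus W i m).lt_of_edge _ _ hn.2
    rcases hab with ⟨rfl, rfl⟩ | ⟨rfl, rfl⟩
    · exact absurd h₂ hsm.le.not_gt
    · exact absurd h₁ hsm.le.not_gt

/-- All other pairs are adjacent, so separated nonempty sets can only be `{i}` and `{m}`, with `S`
forced. Both orders are assumed because `I` need not be symmetric. -/
theorem completeMinus_isIMap {I : Finset (Fin p) → Finset (Fin p) → Finset (Fin p) → Prop}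
    {i m : Fin p} (him : i < m) (hi : i ∈ W) (hm : m ∈ W)
    (h₁ : I {i} {m} ((Finset.Iio m \ {i}) ∩ W)) (h₂ : I {m} {i} ((Finset.Iio m \ {i}) ∩ W)) :
    (completeMinus W i m).IsIMap I := by
  intro A B S hA hB hS hAne hBne hAB hAS hBS hsep
  have key : ∀ a ∈ A, ∀ b ∈ B, (a = i ∧ b = m) ∨ (a = m ∧ b = i) := by
    intro a ha b hb
    by_contra hn
    exact hsep a ha b hb a (.single (completeMinus_adj (hA ha) (hB hb)
      (fun e => Finset.disjoint_left.1 hAB ha (e ▸ hb)) (by tauto) (by tauto)))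
  obtain ⟨a, ha⟩ := hAne
  obtain ⟨b, hb⟩ := hBne
  have hSeq := completeMinus_separator him (key a ha b hb) hi hm hS
    (Finset.disjoint_left.1 hAS ha) (Finset.disjoint_left.1 hBS hb) (hsep a ha b hb)
  have hAeq : A = {a} := Finset.eq_singleton_iff_unique_mem.2 ⟨ha, fun x hx => by
    rcases key a ha b hb with h | h <;> rcases key x hx b hb with h' | h' <;> grind⟩
  have hBeq : B = {b} := Finset.eq_singleton_iff_unique_mem.2 ⟨hb, fun x hx => by
    rcases key a ha b hb with h | h <;> rcases key a ha x hx with h' | h' <;> grind⟩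
  rw [hAeq, hBeq, hSeq]
  rcases key a ha b hb with ⟨rfl, rfl⟩ | ⟨rfl, rfl⟩
  · exact h₁
  · exact h₂

/-- Every I-MAP contains a minimal one. -/
theorem exists_isMinimalIMap {I : Finset (Fin p) → Finset (Fin p) → Finset (Fin p) → Prop}
    (G : OrderedDAG W) (hG : G.IsIMap I) :
    ∃ H : OrderedDAG W, H.IsMinimalIMap I ∧ ∀ a b, H.edge a b → G.edge a b := by
  induction hn : {e : Fin p × Fin p | G.edge e.1 e.2}.ncard using Nat.strong_induction_on
    generalizing G with
  | _ n ih =>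
    by_cases hmin : ∀ i j, G.edge i j → ¬ (G.removeEdge i j).IsIMap I
    · exact ⟨G, ⟨hG, hmin⟩, fun _ _ h => h⟩
    · push Not at hmin
      obtain ⟨i, j, hij, hI⟩ := hmin
      have hlt : {e : Fin p × Fin p | (G.removeEdge i j).edge e.1 e.2}.ncard < n := by
        rw [← hn]
        refine Set.ncard_lt_ncard ⟨fun e he => he.1, fun hsub => ?_⟩ (Set.toFinite _)
        exact (hsub (show (i, j) ∈ {e : Fin p × Fin p | G.edge e.1 e.2} from hij)).2 ⟨rfl, rfl⟩
      obtain ⟨H, hH, hsub⟩ := ih _ hlt (G.removeEdge i j) hI rfl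
      exact ⟨H, hH, fun a b h => (hsub a b h).1⟩

theorem le_of_reflTransGen (G : OrderedDAG W) {a b : Fin p}
    (h : Relation.ReflTransGen G.edge a b) : a ≤ b := by
  induction h with
  | refl => exact le_rfl
  | tail _ h ih => exact ih.trans (G.lt_of_edge _ _ h).le

/-- Nonadjacent vertices are d-separated by the other predecessors of the later one. -/
theorem dSep_of_not_edge (G : OrderedDAG W) {i k : Fin p} (hik : i < k) (h : ¬ G.edge i k) :
    G.DSep {k} {i} ((Finset.Iio k \ {i}) ∩ W) := by
  -- An active trail from `k` either stops at a parent of `k`, which is observed unless it is `i`,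
  -- or keeps descending: a collider beyond `k` has no descendant among the observed predecessors of
  -- `k`.
  have key : ∀ u v, G.ActiveTrail ((Finset.Iio k \ {i}) ∩ W) k u v →
      (u = k ∧ G.edge v k) ∨ (k < v ∧ G.edge u v) := by
    intro u v ht
    induction ht with
    | single hadj =>
      rcases hadj with hadj | hadj
      · exact Or.inr ⟨G.lt_of_edge _ _ hadj, hadj⟩
      · exact Or.inl ⟨rfl, hadj⟩
    | @extend u v w _ hadj hcol hncol ih =>
      rcases ih with ⟨rfl, hvk⟩ | ⟨hkv, huv⟩
      · have hlt := G.lt_of_edge _ _ hvk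
        refine absurd ?_ (hncol fun hc => (G.lt_of_edge _ _ hc.1).not_gt hlt)
        have hvi : v ≠ i := by rintro rfl; exact h hvk
        simp [hlt, hvi, (G.mem_of_edge _ _ hvk).1]
      · rcases hadj with hadj | hadj
        · exact Or.inr ⟨hkv.trans (G.lt_of_edge _ _ hadj), hadj⟩
        · obtain ⟨s, hs, hvs⟩ := hcol ⟨huv, hadj⟩
          simp only [Finset.mem_inter, Finset.mem_sdiff, Finset.mem_Iio] at hs
          exact absurd (hkv.trans_le (G.le_of_reflTransGen hvs)) hs.1.1.not_gt
  intro a ha b hb u ht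
  rw [Finset.mem_singleton] at ha hb
  subst ha hb
  rcases key u _ ht with ⟨_, he⟩ | ⟨hlt, _⟩
  · exact h he
  · exact hlt.not_gt hik

/-- Contrapositive of `dSep_of_not_edge`: statements outside `I` force edges into every I-MAP. -/
theorem IsIMap.edge_of_not {I : Finset (Fin p) → Finset (Fin p) → Finset (Fin p) → Prop}
    {G : OrderedDAG W} (hG : G.IsIMap I) {i k : Fin p} (hi : i ∈ W) (hk : k ∈ W) (hik : i < k)
    (h : ¬ I {k} {i} ((Finset.Iio k \ {i}) ∩ W)) : G.edge i k := by
  by_contra hn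
  refine h (hG _ _ _ (by simpa using hk) (by simpa using hi) Finset.inter_subset_right
    (Finset.singleton_nonempty _) (Finset.singleton_nonempty _) ?_ ?_ ?_
    (G.dSep_of_not_edge hik hn)) <;> simp [hik.ne']

end OrderedDAG

/-! ### Stages of a CStree -/

namespace StagedTree

variable {p : ℕ} {d : Fin p → ℕ} {L : Type*} {𝒯 : StagedTree d L}

theorem stageContext_eq_some {k : Fin p} {v : TreeNode d k.val} {i : Fin p} {a : Fin (d i)} :
    𝒯.stageContext k v i = some a ↔
      ∃ hi : i.val < k.val, v i hi = a ∧ ∀ w, 𝒯.SameStage k v w → w i hi = v i hi := by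
  unfold stageContext
  split_ifs with h₁ h₂
  · simp only [Option.some.injEq]
    exact ⟨fun h => ⟨h₁, h, h₂⟩, fun ⟨_, h, _⟩ => h⟩
  · simp only [false_iff]
    exact fun ⟨_, _, h⟩ => h₂ h
  · simp only [false_iff]
    exact fun ⟨h, _⟩ => h₁ h

theorem lt_of_mem_supp_stageContext {k i : Fin p} {v : TreeNode d k.val}
    (h : i ∈ (𝒯.stageContext k v).supp) : i < k := by
  obtain ⟨a, ha⟩ := Context.mem_supp.1 h
  exact (stageContext_eq_some.1 ha).1

/-- Any context defining the stage is constant on it, hence is contained in `stageContext`, the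
largest such context. -/
theorem IsCStree.sameStage_iff_agrees (h𝒯 : 𝒯.IsCStree) {k : Fin p} {v w : TreeNode d k.val} :
    𝒯.SameStage k v w ↔ (𝒯.stageContext k v).Agrees w := by
  constructor
  · intro h i hi a ha
    obtain ⟨_, rfl, h'⟩ := stageContext_eq_some.1 ha
    exact h' w h
  · intro h
    obtain ⟨c, hc, hstage⟩ := h𝒯.stage_eq k v
    rw [hstage]
    intro i hi a ha
    have hv : v i hi = a := (hstage v).1 rfl i hi a ha
    refine h i hi a (stageContext_eq_some.2 ⟨hi, hv, fun u hu => ?_⟩)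
    rw [hv]
    exact (hstage u).1 hu i hi a ha

theorem stageContext_congr {k : Fin p} {v w : TreeNode d k.val} (h : 𝒯.SameStage k v w) :
    𝒯.stageContext k v = 𝒯.stageContext k w := by
  funext i
  refine Option.ext fun a => ?_
  rw [stageContext_eq_some, stageContext_eq_some]
  have h' : Set.range (𝒯.label k v) = Set.range (𝒯.label k w) := h
  constructor
  · rintro ⟨hi, rfl, hu⟩
    exact ⟨hi, hu w h, fun u hwu => (hu u (h'.trans hwu)).trans (hu w h).symm⟩
  · rintro ⟨hi, rfl, hu⟩
    exact ⟨hi, hu v h'.symm, fun u hvu => (hu u (h'.symm.trans hvu)).trans (hu v h'.symm).symm⟩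

/-- Different stages of one level have incompatible contexts. -/
theorem IsCStree.sameStage_of_compatible (h𝒯 : 𝒯.IsCStree) {k : Fin p} {v w : TreeNode d k.val}
    (h : (𝒯.stageContext k v).Compatible (𝒯.stageContext k w)) : 𝒯.SameStage k v w := by
  classical
  -- Gluing `w` on its own context with `v` elsewhere gives, by compatibility, a vertex in both
  -- stages.
  let u : TreeNode d k.val := fun i hi => if i ∈ (𝒯.stageContext k w).supp then w i hi else v i hi
  have hw : 𝒯.SameStage k w u := by
    rw [h𝒯.sameStage_iff_agrees]
    intro i hi a ha
    have hmem : i ∈ (𝒯.stageContext k w).supp := Context.mem_supp.2 ⟨a, ha⟩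
    simp only [u, hmem, if_true]
    exact (stageContext_eq_some.1 ha).2.1
  have hv : 𝒯.SameStage k v u := by
    rw [h𝒯.sameStage_iff_agrees]
    intro i hi a ha
    by_cases hmem : i ∈ (𝒯.stageContext k w).supp
    · obtain ⟨b, hb⟩ := Context.mem_supp.1 hmem
      simp only [u, hmem, if_true]
      rw [h i a b ha hb]
      exact (stageContext_eq_some.1 hb).2.1
    · simp only [u, hmem, if_false]
      exact (stageContext_eq_some.1 ha).2.1
  exact Eq.trans hv (Eq.symm hw)

/-- The level `j` of the statement decides the alternative. For `j < k`, `X_k` does not occur. For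
`j = k`, the contexts are incompatible or the stages coincide, and then `B` avoids the context. For
`j > k`, `A = {j}` lies beyond `k` and its context. -/
theorem IsCStree.untangled_of_mem_stageStatements (h𝒯 : 𝒯.IsCStree) (k : Fin p)
    (v : TreeNode d k.val) : ∀ σ ∈ 𝒯.stageStatements, σ.Untangled k (𝒯.stageContext k v) := by
  rintro σ ⟨j, w, rfl⟩
  rcases lt_trichotomy j k with hjk | rfl | hkj
  · refine Or.inl ⟨by simpa using hjk.ne', ?_, by simp, fun hk => ?_⟩
    · simp [hjk.not_gt]
    · exact (lt_of_mem_supp_stageContext hk).not_gt hjk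
  · by_cases hc : (𝒯.stageContext j w).Compatible (𝒯.stageContext j v)
    · refine Or.inr (Or.inr (Or.inr ?_))
      rw [stageContext_congr (h𝒯.sameStage_of_compatible hc)]
      simp [Finset.disjoint_insert_right, Finset.sdiff_disjoint]
    · exact Or.inr (Or.inl hc)
  · refine Or.inr (Or.inr (Or.inl ?_))
    rw [Finset.disjoint_singleton_left, Finset.mem_insert, not_or]
    exact ⟨hkj.ne', fun hj => (lt_of_mem_supp_stageContext hj).not_gt hkj⟩

/-- `X_k` is not independent of a variable in the context of one of its stages, given any context
compatible with that stage. -/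
theorem IsCStree.not_implies (h𝒯 : 𝒯.IsCStree) {k i : Fin p} {v : TreeNode d k.val}
    {c : Context d} (hc : c.Compatible (𝒯.stageContext k v))
    (hi : i ∈ (𝒯.stageContext k v).supp) (S : Finset (Fin p)) : ¬ 𝒯.Implies ⟨{k}, {i}, S, c⟩ := by
  intro h
  have h' := CSIClosure.untangled (h𝒯.untangled_of_mem_stageStatements k v) h
  simp [CSIStatement.Untangled, hc, hi] at h'

/-- Weak union isolates `i` in the stage statement. A maximal `T` that can be moved from the context
into the conditioning set leaves a minimal context, and the conditioning set becomes all
predecessors of `m` except `i` outside that context. -/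
theorem exists_isMinimalContext {m i : Fin p} {v : TreeNode d m.val} (him : i < m)
    (hi : i ∉ (𝒯.stageContext m v).supp) :
    ∃ T ⊆ (𝒯.stageContext m v).supp, 𝒯.IsMinimalContext ((𝒯.stageContext m v).erase T) ∧
      𝒯.ContextCI ((𝒯.stageContext m v).erase T) {m} {i}
        ((Finset.Iio m \ {i}) ∩ ((𝒯.stageContext m v).erase T).suppᶜ) := by
  classical
  set c := 𝒯.stageContext m v with hc
  set S := (Finset.Iio m \ {i}) \ c.supp with hS
  have hbase : 𝒯.Implies ⟨{m}, {i}, S, c⟩ := by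
    have h₀ : 𝒯.Implies ⟨{m}, Finset.Iio m \ c.supp, ∅, c⟩ := .of_base ⟨m, v, rfl⟩
    have hsplit : Finset.Iio m \ c.supp = {i} ∪ S := by
      ext j
      simp only [hS, Finset.mem_sdiff, Finset.mem_Iio, Finset.mem_union, Finset.mem_singleton]
      by_cases hj : j = i
      · subst hj
        simp [him, hi]
      · simp [hj]
    rw [hsplit] at h₀
    have h₁ := CSIClosure.weak_union (by simp [hS]) h₀
    rwa [Finset.empty_union] at h₁
  obtain ⟨T, hT⟩ := (Set.toFinite
    {T : Finset (Fin p) | T ⊆ c.supp ∧ 𝒯.Implies ⟨{m}, {i}, S ∪ T, c.erase T⟩}).exists_maximal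
    ⟨∅, by simp, by simpa [Context.erase_empty] using hbase⟩
  refine ⟨T, hT.prop.1, ⟨{m}, {i}, S ∪ T, by simp, by simp, hT.prop.2, fun U hU hUne h => ?_⟩, ?_⟩
  · rw [Context.erase_erase, Finset.union_assoc] at h
    rw [Context.supp_erase] at hU
    have hle := hT.le_of_ge ⟨Finset.union_subset hT.prop.1 (hU.trans Finset.sdiff_subset), h⟩
      Finset.subset_union_left
    obtain ⟨u, hu⟩ := hUne
    exact (Finset.mem_sdiff.1 (hU hu)).2 (hle (Finset.mem_union_right _ hu))
  · have heq : (Finset.Iio m \ {i}) ∩ (c.erase T).suppᶜ = S ∪ T := by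
      rw [Context.supp_erase]
      ext j
      simp only [hS, Finset.mem_inter, Finset.mem_sdiff, Finset.mem_Iio, Finset.mem_singleton,
        Finset.mem_compl, Finset.mem_union]
      have hj : j ∈ T → j ∈ c.supp := fun h => hT.prop.1 h
      have hj' : j ∈ c.supp → j < m := fun h => lt_of_mem_supp_stageContext h
      have hj'' : j ∈ c.supp → j ≠ i := by rintro h rfl; exact hi h
      tauto
    rw [heq]
    exact hT.prop.2

/-- If all minimal context DAGs are perfect, then in the context of a stage every variable depends,
in its own stage, on all earlier variables of the context. -/
theorem IsCStree.mem_supp_stageContext (h𝒯 : 𝒯.IsCStree)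
    (hperfect : ∀ (c : Context d) (G : OrderedDAG (c.supp)ᶜ),
      𝒯.IsMinimalContextDAG c G → G.IsPerfect) (x : Outcome d) {n m i : Fin p} (him : i < m)
    (hm : m ∈ (𝒯.stageContext n (x.truncate n.val)).supp)
    (hi : i ∈ (𝒯.stageContext n (x.truncate n.val)).supp) :
    i ∈ (𝒯.stageContext m (x.truncate m.val)).supp := by
  by_contra hn
  obtain ⟨T, hT, hmin, hCI⟩ := exists_isMinimalContext him hn
  set c := 𝒯.stageContext m (x.truncate m.val) with hc
  have hlt : ∀ j ∈ (c.erase T).supp, j ∈ c.supp := fun j hj => by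
    rw [Context.supp_erase] at hj
    exact (Finset.mem_sdiff.1 hj).1
  have hiW : i ∈ (c.erase T).suppᶜ := Finset.mem_compl.2 fun h => hn (hlt i h)
  have hW : ∀ j, m ≤ j → j ∈ (c.erase T).suppᶜ := fun j hj => Finset.mem_compl.2 fun h =>
    (lt_of_mem_supp_stageContext (hlt j h)).not_ge hj
  have hmn : m < n := lt_of_mem_supp_stageContext hm
  -- Both contexts are read off the same outcome `x`.
  have hcompat : (c.erase T).Compatible (𝒯.stageContext n (x.truncate n.val)) := by
    intro j a b ha hb
    obtain ⟨_, ha', _⟩ := stageContext_eq_some.1 (Context.erase_eq_some.1 ha).2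
    obtain ⟨_, hb', _⟩ := stageContext_eq_some.1 hb
    exact ha'.symm.trans hb'
  -- Minimizing inside `completeMinus` guarantees that `G` also lacks `i → m`.
  obtain ⟨G, hG, hsub⟩ := OrderedDAG.exists_isMinimalIMap _
    (OrderedDAG.completeMinus_isIMap him hiW (hW m le_rfl) (CSIClosure.symmetry hCI) hCI)
  have hin := hG.1.edge_of_not hiW (hW n hmn.le) (him.trans hmn) (h𝒯.not_implies hcompat hi _)
  have hmn' := hG.1.edge_of_not (hW m le_rfl) (hW n hmn.le) hmn (h𝒯.not_implies hcompat hm _)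
  rcases hperfect _ G ⟨hmin, hG⟩ n i m hin hmn' him.ne with h | h
  · exact (hsub _ _ h).2.2.2 ⟨rfl, rfl⟩
  · exact (G.lt_of_edge _ _ h).not_gt him

/-! ### Factorization of the interpolating polynomials -/

/-- `F` depends on an outcome only through the stage at level `j` and the outcome of `X_j`. -/
def StageMeasurable (𝒯 : StagedTree d L) (j : Fin p) (F : Outcome d → MvPolynomial L ℝ) : Prop :=
  ∀ x y : Outcome d, 𝒯.SameStage j (x.truncate j.val) (y.truncate j.val) → x j = y j → F x = F y

theorem truncate_update_of_le (x : Outcome d) {K j : Fin p} (hj : j ≤ K) (s : Fin (d K)) :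
    Outcome.truncate (Function.update x K s) j.val = x.truncate j.val := by
  funext i hi
  have hi' : i < K := lt_of_lt_of_le hi hj
  simp [Outcome.truncate, Function.update_of_ne hi'.ne]

theorem truncate_child (x : Outcome d) (k : Fin p) (s : Fin (d k)) :
    (x.truncate k.val).child s = Outcome.truncate (Function.update x k s) (k.val + 1) := by
  funext i hi
  by_cases h : i.val < k.val
  · have hne : i ≠ k := fun e => by simp [e] at h
    simp [TreeNode.child, Outcome.truncate, h, Function.update_of_ne hne]
  · obtain rfl : k = i := Fin.ext (by omega)
    simp [TreeNode.child, Outcome.truncate]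

theorem truncate_succ_eq_iff (x y : Outcome d) (k : Fin p) :
    y.truncate (k.val + 1) = x.truncate (k.val + 1) ↔
      y.truncate k.val = x.truncate k.val ∧ y k = x k := by
  constructor
  · intro h
    exact ⟨funext fun i => funext fun hi => congrFun (congrFun h i) (by omega),
      congrFun (congrFun h k) (by omega)⟩
  · rintro ⟨h₁, h₂⟩
    funext i hi
    by_cases h : i.val < k.val
    · exact congrFun (congrFun h₁ i) h
    · obtain rfl : k = i := Fin.ext (by omega)
      exact h₂

/-- The leaves below the vertex are grouped by their outcome of `X_k`. -/
theorem interpolatingPoly_eq_sum_update (𝒯 : StagedTree d L) (x : Outcome d) (k : Fin p) :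
    𝒯.interpolatingPoly (x.truncate k.val) =
      ∑ s, MvPolynomial.X (𝒯.label k (x.truncate k.val) s) *
        𝒯.interpolatingPoly (Outcome.truncate (Function.update x k s) (k.val + 1)) := by
  classical
  have hsplit : Finset.univ.filter (fun j : Fin p => k.val ≤ j.val) =
      insert k (Finset.univ.filter fun j : Fin p => k.val + 1 ≤ j.val) := by
    ext j
    simp only [Finset.mem_filter, Finset.mem_univ, true_and, Finset.mem_insert, Fin.ext_iff]
    omega
  unfold interpolatingPoly
  rw [← Finset.sum_fiberwise _ (fun y : Outcome d => y k)]
  refine Finset.sum_congr rfl fun s _ => ?_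
  rw [Finset.mul_sum, Finset.filter_filter]
  refine Finset.sum_congr ?_ ?_
  · ext y
    simp only [Finset.mem_filter, Finset.mem_univ, true_and]
    rw [truncate_succ_eq_iff, truncate_update_of_le x le_rfl, Function.update_self]
  · intro y hy
    simp only [Finset.mem_filter, Finset.mem_univ, true_and] at hy
    rw [truncate_succ_eq_iff, truncate_update_of_le x le_rfl, Function.update_self] at hy
    rw [hsplit, Finset.prod_insert (by simp), hy.1, hy.2]

/-- A function of the stage at level `n` is a product of functions of the stages and outcomes at the
earlier levels. -/
theorem IsCStree.exists_prod_eq (h𝒯 : 𝒯.IsCStree)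
    (hperfect : ∀ (c : Context d) (G : OrderedDAG (c.supp)ᶜ),
      𝒯.IsMinimalContextDAG c G → G.IsPerfect) (n : Fin p) (Φ : Outcome d → MvPolynomial L ℝ)
    (hΦ : ∀ x y : Outcome d, 𝒯.SameStage n (x.truncate n.val) (y.truncate n.val) → Φ x = Φ y) :
    ∃ (a : MvPolynomial L ℝ) (F : Fin p → Outcome d → MvPolynomial L ℝ),
      (∀ j, 𝒯.StageMeasurable j (F j)) ∧ ∀ x, Φ x = a * ∏ j ∈ Finset.Iio n, F j x := by
  classical
  let C : Outcome d → Finset (Fin p) := fun x => (𝒯.stageContext n (x.truncate n.val)).supp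
  -- A stage with empty context fills its level, so `Φ` is constant.
  by_cases hex : ∃ x, C x = ∅
  · obtain ⟨x₀, hx₀⟩ := hex
    refine ⟨Φ x₀, fun _ _ => 1, fun _ _ _ _ _ => rfl, fun x => ?_⟩
    have hsame : 𝒯.SameStage n (x₀.truncate n.val) (x.truncate n.val) := by
      rw [h𝒯.sameStage_iff_agrees]
      intro i hi b hb
      have hmem : i ∈ C x₀ := Context.mem_supp.2 ⟨b, hb⟩
      simp [hx₀] at hmem
    simp [hΦ _ _ hsame]
  · push Not at hex
    -- If `j` is the last context variable, nesting puts the other ones into the context at level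
    -- `j`. The stage and outcome at `j` therefore fix the whole context at level `n`.
    have hone : ∀ x y : Outcome d, ∀ j, 𝒯.SameStage j (x.truncate j.val) (y.truncate j.val) →
        x j = y j → j = (C x).max' (hex x) →
        𝒯.SameStage n (x.truncate n.val) (y.truncate n.val) := by
      intro x y j hxy hj hmax
      rw [h𝒯.sameStage_iff_agrees]
      intro i hi b hb
      have hiC : i ∈ C x := Context.mem_supp.2 ⟨b, hb⟩
      have hjC : j ∈ C x := hmax ▸ Finset.max'_mem _ _
      have hxb : x i = b := (stageContext_eq_some.1 hb).2.1
      rw [← hxb]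
      rcases (hmax ▸ Finset.le_max' _ i hiC : i ≤ j).lt_or_eq with hij | rfl
      · obtain ⟨b', hb'⟩ := Context.mem_supp.1 (h𝒯.mem_supp_stageContext hperfect x hij hjC hiC)
        obtain ⟨hi', _, hall⟩ := stageContext_eq_some.1 hb'
        exact hall _ hxy
      · exact hj.symm
    -- For each `x` a single factor carries all of `Φ`; its level may vary with `x`.
    refine ⟨1, fun j x => if j = (C x).max' (hex x) then Φ x else 1, fun j x y hxy hj => ?_,
      fun x => ?_⟩
    · have hC : 𝒯.SameStage n (x.truncate n.val) (y.truncate n.val) →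
          (C x).max' (hex x) = (C y).max' (hex y) := fun h => by
        simp only [C, stageContext_congr h]
      by_cases hx : j = (C x).max' (hex x)
      · have h := hone x y j hxy hj hx
        simp only [← hC h, ← hx, if_true]
        exact hΦ x y h
      · have hy : j ≠ (C y).max' (hex y) := fun hy =>
          hx (hy.trans (hC (Eq.symm (hone y x j (Eq.symm hxy) hj.symm hy))).symm)
        simp [hx, hy]
    · have hlt : (C x).max' (hex x) ∈ Finset.Iio n :=
        Finset.mem_Iio.2 (lt_of_mem_supp_stageContext (Finset.max'_mem _ (hex x)))
      rw [one_mul, Finset.prod_ite_eq' (Finset.Iio n) ((C x).max' (hex x)) fun _ => Φ x,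
        if_pos hlt]

/-- The interpolating polynomials at level `K` are products of functions of the stages and outcomes
at the earlier levels. -/
theorem IsCStree.interpolatingPoly_eq_prod (h𝒯 : 𝒯.IsCStree)
    (hperfect : ∀ (c : Context d) (G : OrderedDAG (c.supp)ᶜ),
      𝒯.IsMinimalContextDAG c G → G.IsPerfect) {K : ℕ} (hK : K ≤ p) :
    ∃ (a : MvPolynomial L ℝ) (F : Fin p → Outcome d → MvPolynomial L ℝ),
      (∀ j, 𝒯.StageMeasurable j (F j)) ∧ ∀ x : Outcome d, 𝒯.interpolatingPoly (x.truncate K) =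
        a * ∏ j ∈ Finset.univ.filter (fun j : Fin p => j.val < K), F j x := by
  classical
  induction hK using Nat.decreasingInduction with
  | self =>
    refine ⟨1, fun _ _ => 1, fun _ _ _ _ _ => rfl, fun x => ?_⟩
    have hfilter : Finset.univ.filter (fun y : Outcome d => y.truncate p = x.truncate p) = {x} := by
      ext y
      simp only [Finset.mem_filter, Finset.mem_univ, true_and, Finset.mem_singleton]
      exact ⟨fun h => funext fun i => congrFun (congrFun h i) i.isLt, fun h => h ▸ rfl⟩
    have hempty : Finset.univ.filter (fun j : Fin p => p ≤ j.val) = ∅ :=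
      Finset.filter_eq_empty_iff.2 fun j _ => j.isLt.not_ge
    simp [interpolatingPoly, hfilter, hempty]
  | of_succ n hn ih =>
    obtain ⟨a, F, hF, hprod⟩ := ih
    let k : Fin p := ⟨n, hn⟩
    have hIio : Finset.univ.filter (fun j : Fin p => j.val < n) = Finset.Iio k := by
      ext j
      simp [k, Fin.lt_def]
    have hsplit : Finset.univ.filter (fun j : Fin p => j.val < n + 1) =
        insert k (Finset.Iio k) := by
      ext j
      simp only [Finset.mem_filter, Finset.mem_univ, true_and, Finset.mem_insert, Finset.mem_Iio,
        Fin.ext_iff, Fin.lt_def, k]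
      omega
    -- Summing out `X_k` affects only the factor at level `k`; the result depends only on the stage
    -- at `k`, so it can be redistributed over earlier levels.
    let Φ : Outcome d → MvPolynomial L ℝ := fun x =>
      ∑ s, MvPolynomial.X (𝒯.label k (x.truncate k.val) s) * F k (Function.update x k s)
    obtain ⟨b, F', hF', hΦ⟩ := h𝒯.exists_prod_eq hperfect k Φ fun x y hxy =>
      Finset.sum_congr rfl fun s _ => by
        rw [h𝒯.label_eq k _ _ hxy s]
        congr 1
        refine hF k _ _ ?_ (by simp)
        rwa [truncate_update_of_le x le_rfl, truncate_update_of_le y le_rfl]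
    refine ⟨a * b, fun j x => F j x * F' j x, fun j x y hxy hj => ?_, fun x => ?_⟩
    · simp only [hF j x y hxy hj, hF' j x y hxy hj]
    · have hstep : ∀ s, 𝒯.interpolatingPoly
          (Outcome.truncate (Function.update x k s) (k.val + 1)) =
          a * (F k (Function.update x k s) * ∏ j ∈ Finset.Iio k, F j x) := by
        intro s
        rw [hprod, hsplit, Finset.prod_insert (by simp)]
        congr 2
        refine Finset.prod_congr rfl fun j hj => hF j _ _ ?_ ?_
        · rw [truncate_update_of_le x (Finset.mem_Iio.1 hj).le]
          rfl
        · exact Function.update_of_ne (Finset.mem_Iio.1 hj).ne _ _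
      have hrec := 𝒯.interpolatingPoly_eq_sum_update x k
      simp only [hstep] at hrec
      calc 𝒯.interpolatingPoly (x.truncate n)
          = Φ x * (a * ∏ j ∈ Finset.Iio k, F j x) := by
            rw [show 𝒯.interpolatingPoly (x.truncate n) = _ from hrec, Finset.sum_mul]
            exact Finset.sum_congr rfl fun s _ => by ring
        _ = _ := by
            rw [hΦ, hIio, Finset.prod_mul_distrib]
            ring

theorem interpolatingPoly_eq_zero_of_isEmpty [IsEmpty (Outcome d)] (𝒯 : StagedTree d L) {k : ℕ}
    (v : TreeNode d k) : 𝒯.interpolatingPoly v = 0 := by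
  simp [interpolatingPoly, Finset.univ_eq_empty]

theorem exists_truncate_eq [Nonempty (Outcome d)] {k : ℕ} (v : TreeNode d k) :
    ∃ x : Outcome d, x.truncate k = v := by
  obtain ⟨x₀⟩ := ‹Nonempty (Outcome d)›
  refine ⟨fun i => if h : i.val < k then v i h else x₀ i, ?_⟩
  funext i hi
  simp [Outcome.truncate, hi]

end StagedTree

/-! ### Balancedness from the factorization. -/

theorem mainTheorem6 {p : ℕ} {d : Fin p → ℕ} {L : Type*} (𝒯 : StagedTree d L)
    (h𝒯 : 𝒯.IsCStree)
    (hperfect : ∀ (c : Context d) (G : OrderedDAG (c.supp)ᶜ),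
      𝒯.IsMinimalContextDAG c G → G.IsPerfect) :
    𝒯.IsBalanced := by
  intro k v w hvw s r
  -- Some `d i` may be `0`; then there are no leaves and all the polynomials vanish. Otherwise every
  -- vertex extends to a leaf.
  rcases isEmpty_or_nonempty (Outcome d) with hempty | hne
  · simp [StagedTree.interpolatingPoly_eq_zero_of_isEmpty]
  obtain ⟨x, rfl⟩ := StagedTree.exists_truncate_eq v
  obtain ⟨y, rfl⟩ := StagedTree.exists_truncate_eq w
  obtain ⟨a, F, hF, hprod⟩ := h𝒯.interpolatingPoly_eq_prod hperfect (Nat.succ_le_of_lt k.isLt)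
  have hsplit : Finset.univ.filter (fun j : Fin p => j.val < k.val + 1) =
      insert k (Finset.Iio k) := by
    ext j
    simp only [Finset.mem_filter, Finset.mem_univ, true_and, Finset.mem_insert, Finset.mem_Iio,
      Fin.ext_iff, Fin.lt_def]
    omega
  have hchild : ∀ (z : Outcome d) (q : Fin (d k)),
      𝒯.interpolatingPoly ((z.truncate k.val).child q) =
        a * (F k (Function.update z k q) * ∏ j ∈ Finset.Iio k, F j z) := by
    intro z q
    rw [StagedTree.truncate_child, hprod, hsplit, Finset.prod_insert (by simp)]
    congr 2
    refine Finset.prod_congr rfl fun j hj => hF j _ _ ?_ ?_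
    · rw [StagedTree.truncate_update_of_le z (Finset.mem_Iio.1 hj).le]
      rfl
    · exact Function.update_of_ne (Finset.mem_Iio.1 hj).ne _ _
  -- The only factor that depends on the appended outcome is common to both vertices, so each side
  -- of the equation is symmetric in `s` and `r`.
  have hstage : ∀ q, F k (Function.update x k q) = F k (Function.update y k q) := by
    intro q
    refine hF k _ _ ?_ (by simp)
    rwa [StagedTree.truncate_update_of_le x le_rfl, StagedTree.truncate_update_of_le y le_rfl]
  simp only [hchild, hstage]
  ring
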